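/- Let $K$ be a (nonempty, pathwise connected) poset. A $1$-simplex $b$ of $K$ consists of a starting point $\partial_1 b\in K$, an end point $\partial_0 b\in K$ and a support $|b|\in K$ with $\partial_0b,\partial_1b\le |b|$. A $2$-simplex $c$ consists of $1$-simplices $\partial_2c:x\to y$, $\partial_0c:y\to z$, $\partial_1c:x\to z$ and a support $|c|\in K$ which is larger than their supports. A path $p=b_n*\cdots*b_1$ ($n\ge1$) is a finite sequence of consecutive $1$-simplices. Two paths are homotopic if one is obtained from the other by finitely many replacements of consecutive $1$-simplices $\partial_0c*\partial_2c$ by $\partial_1c$, or conversely, with $c$ a $2$-simplex. Pathwise connected means that any two points of $K$ are joined by a path. For $o\le a$, $(ao)$ denotes the $1$-simplex from $o$ to $a$ with support $a$. A net of $C^*$-algebras $(\mathcal A,\jmath)_K$ consists of unital $C^*$-algebras $\mathcal A_o$ ($o\in K$) and injective unital $*$-morphisms $\jmath_{oa}:\mathcal A_a\to\mathcal A_o$ ($a\le o$) with $\jmath_{oa}\circ\jmath_{ae}=\jmath_{oe}$ for $e\le a\le o$. It is a $C^*$-net bundle if all $\jmath_{oa}$ are isomorphisms, and it is trivial if there are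 a $C^*$-algebra $F$ and $*$-isomorphisms $\phi_o:\mathcal A_o\to F$ with $\phi_o\circ\jmath_{oa}=\phi_a$ for all $a\le o$. The enveloping net bundle $(\overline{\mathcal A},\overline\jmath)_K$ is defined as follows. Let $\overline{\mathcal A}{}^0_o$ be the unital complex $*$-algebra generated by the symbols $(p,A)$, with $p$ a path from a point $a$ to $o$ and $A\in\mathcal A_a$, with $(p,A)^*=(p,A^*)$ and subject to the relations: for each path $p:a\to o$ the map $A\mapsto(p,A)$ is linear, multiplicative and unital; $(p,\jmath_{\tilde aa}(A))=(p*(\tilde aa),A)$ for $a\le\tilde a$, $p:\tilde a\to o$, $A\in\mathcal A_a$; and $(p,A)=(q,A)$ if $p$ and $q$ are homotopic. For $o\le\tilde o$ let $\overline\jmath_{\tilde oo}(p,A):=((\tilde oo)*p,A)$. Then $\overline{\mathcal A}_o$ is the Hausdorff completion of $\overline{\mathcal A}{}^0_o$ in the seminorm $\|W\|=\sup_\pi\|\pi_o(W)\|$, where $\pi=(\pi_o)_{o\in K}$ runs over all families of (not necessarily unital) $*$-morphisms from the $\overline{\mathcal A}{}^0_o$ to the fibres of a $C^*$-net bundle over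 $K$ which intertwine the inclusion maps. The net $(\mathcal A,\jmath)_K$ is nondegenerate if $(\overline{\mathcal A},\overline\jmath)_K$ does not vanish, i.e. if its fibres are not all $\{0\}$. A representation $(\pi,U)$ of $(\mathcal A,\jmath)_K$ consists of (not necessarily unital) $*$-representations $\pi_o:\mathcal A_o\to\mathcal B(\mathcal H_o)$ on Hilbert spaces $\mathcal H_o$, $o\in K$, and unitaries $U_{ao}:\mathcal H_o\to\mathcal H_a$, $o\le a$, with $U_{ao}\,\pi_o(A)=\pi_a(\jmath_{ao}(A))\,U_{ao}$ for $A\in\mathcal A_o$, and $U_{ea}U_{ao}=U_{eo}$ for $o\le a\le e$. Put $U_b:=U_{|b|\,\partial_0b}^{*}\,U_{|b|\,\partial_1b}$ for a $1$-simplex $b$ and $U_p:=U_{b_n}\cdots U_{b_1}$ for a path $p=b_n*\cdots*b_1$. The representation is quasi-trivial if for every $o\in K$ and every loop $p:o\to o$ the unitary $U_p$ commutes with $\pi_o(A)$ for all $A\in\mathcal A_o$. **Proposition.** Let $(\mathcal A,\jmath)_K$ be a nondegenerate net of $C^*$-algebras over a pathwise connected poset $K$. Its enveloping net bundle is trivial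 if and only if every representation of $(\mathcal A,\jmath)_K$ is quasi-trivial. -/

import Mathlib

universe u v w

noncomputable section

open UniformSpace (Completion)

namespace CStarNet

/-! ### Simplices, paths and homotopy in a poset -/

section Poset

variable {K : Type v} [PartialOrder K]

/-- A 1-simplex `b` with starting vertex `x = ∂₁b` and final vertex `y = ∂₀b`. -/
@[ext]
structure Edge (x y : K) where
  support : K
  source_le : x ≤ support
  target_le : y ≤ support

/-- The 1-simplex `(ao)` of the nerve attached to `o ≤ a`: it starts at `o`, ends at `a` and
its support is `a`. -/
def Edge.ofLE {o a : K} (h : o ≤ a) : Edge o a := ⟨a, h, le_rfl⟩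

/-- The opposite of a 1-simplex. -/
def Edge.opp {x y : K} (b : Edge x y) : Edge y x := ⟨b.support, b.target_le, b.source_le⟩

/-- The degenerate 1-simplex `σ₀ o`, i.e. the trivial loop over `o`. -/
def Edge.degenerate (o : K) : Edge o o := ⟨o, le_rfl, le_rfl⟩

/-- A 2-simplex `c` with vertices `x, y, z`: three 1-simplices `∂₂c : x → y`, `∂₀c : y → z`,
`∂₁c : x → z` and a support which is larger than the supports of the faces. -/
structure Triangle (x y z : K) where
  d0 : Edge y z
  d1 : Edge x z
  d2 : Edge x y
  support : K
  d0_le : d0.support ≤ support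
  d1_le : d1.support ≤ support
  d2_le : d2.support ≤ support

/-- Paths `b_n * ⋯ * b_1`, `n ≥ 1`, from the first argument to the second one. The constructor
`cons b p` is the path `b * p` (first `p`, then `b`). -/
inductive Path : K → K → Type v
  | single {x y : K} (b : Edge x y) : Path x y
  | cons {x y z : K} (b : Edge y z) (p : Path x y) : Path x z

namespace Path

/-- The composition `q * p` (first `p`, then `q`). -/
def comp {x y z : K} : Path y z → Path x y → Path x z
  | single b, p => cons b p
  | cons b q, p => cons b (comp q p)

theorem comp_assoc {x y z t : K} (r : Path z t) (q : Path y z) (p : Path x y) :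
    (r.comp q).comp p = r.comp (q.comp p) := by
  induction r with
  | single b => rfl
  | cons b r ih => simp [comp, ih]

/-- `Deformation p q`: the path `q` arises from `p` by replacing two consecutive 1-simplices
`∂₀c * ∂₂c` by `∂₁c`, where `c` is a 2-simplex. -/
inductive Deformation : ∀ {x y : K}, Path x y → Path x y → Prop
  | face {x y z : K} (c : Triangle x y z) :
      Deformation (cons c.d0 (single c.d2)) (single c.d1)
  | left {x y z : K} (r : Path y z) {p q : Path x y} (h : Deformation p q) :
      Deformation (r.comp p) (r.comp q)
  | right {x y z : K} {p q : Path y z} (h : Deformation p q) (r : Path x y) :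
      Deformation (p.comp r) (q.comp r)

/-- Homotopy equivalence of paths: one is obtained from the other by finitely many
deformations and inverse deformations. -/
def Homotopic {x y : K} (p q : Path x y) : Prop := Relation.EqvGen Deformation p q

theorem Homotopic.left {x y z : K} (r : Path y z) {p q : Path x y} (h : Homotopic p q) :
    Homotopic (r.comp p) (r.comp q) := by
  induction h with
  | rel _ _ h => exact .rel _ _ (.left r h)
  | refl _ => exact .refl _
  | symm _ _ _ ih => exact .symm _ _ ih
  | trans _ _ _ _ _ ih₁ ih₂ => exact .trans _ _ _ ih₁ ih₂

theorem Homotopic.right {x y z : K} {p q : Path y z} (h : Homotopic p q) (r : Path x y) :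
    Homotopic (p.comp r) (q.comp r) := by
  induction h with
  | rel _ _ h => exact .rel _ _ (.right h r)
  | refl _ => exact .refl _
  | symm _ _ _ ih => exact .symm _ _ ih
  | trans _ _ _ _ _ ih₁ ih₂ => exact .trans _ _ _ ih₁ ih₂

theorem homotopic_ofLE_trans {e a o : K} (h₁ : e ≤ a) (h₂ : a ≤ o) :
    Homotopic (cons (Edge.ofLE h₂) (single (Edge.ofLE h₁)))
      (single (Edge.ofLE (h₁.trans h₂))) :=
  .rel _ _ (.face ⟨Edge.ofLE h₂, Edge.ofLE (h₁.trans h₂), Edge.ofLE h₁, o, le_rfl, le_rfl, h₂⟩)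

theorem homotopic_degenerate_comp {x y : K} (p : Path x y) :
    Homotopic ((single (Edge.degenerate y)).comp p) p := by
  cases p with
  | single b =>
    exact .rel _ _ (.face ⟨Edge.degenerate y, b, b, b.support, b.target_le, le_rfl, le_rfl⟩)
  | cons b q =>
    exact Homotopic.right (p := cons (Edge.degenerate y) (single b)) (q := single b)
      (.rel _ _ (.face ⟨Edge.degenerate y, b, b, b.support, b.target_le, le_rfl, le_rfl⟩)) q

theorem homotopic_opp_comp {x y : K} (b : Edge x y) :
    Homotopic ((single b.opp).comp (single b)) (single (Edge.degenerate x)) :=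
  .rel _ _ (.face ⟨b.opp, Edge.degenerate x, b, b.support, le_rfl, b.source_le, le_rfl⟩)

theorem homotopic_comp_opp {x y : K} (b : Edge x y) :
    Homotopic ((single b).comp (single b.opp)) (single (Edge.degenerate y)) :=
  homotopic_opp_comp b.opp

end Path

/-- A poset is (nonempty and) pathwise connected if any two elements are joined by a path. -/
def PathConnected (K : Type v) [PartialOrder K] : Prop :=
  Nonempty K ∧ ∀ a o : K, Nonempty (Path a o)

end Poset

/-! ### Nets of C⋆-algebras -/

/-- A net of (unital) C⋆-algebras over `K`, with unital faithful inclusion maps. -/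
structure Net (K : Type v) [PartialOrder K] where
  A : K → Type u
  [cstar : ∀ o, CStarAlgebra (A o)]
  j : ∀ {a o : K}, a ≤ o → (A a →⋆ₐ[ℂ] A o)
  j_injective : ∀ {a o : K} (h : a ≤ o), Function.Injective (j h)
  j_comp : ∀ {e a o : K} (h₁ : e ≤ a) (h₂ : a ≤ o) (x : A e),
    j h₂ (j h₁ x) = j (h₁.trans h₂) x

attribute [instance] Net.cstar

section Nets

variable {K : Type v} [PartialOrder K]

/-- A C⋆-net bundle is a net whose inclusion maps are all isomorphisms. -/
def Net.IsNetBundle (N : Net.{u} K) : Prop :=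
  ∀ {a o : K} (h : a ≤ o), Function.Bijective (N.j h)

/-- The constant net bundle with fibre `F`. -/
def Net.const (K : Type v) [PartialOrder K] (F : Type u) [CStarAlgebra F] : Net.{u} K where
  A _ := F
  j _ := StarAlgHom.id ℂ F
  j_injective _ := Function.injective_id
  j_comp _ _ _ := rfl

/-- An isomorphism of nets over `K`. -/
structure Net.Iso (N M : Net.{u} K) where
  φ : ∀ o, N.A o ≃⋆ₐ[ℂ] M.A o
  comm : ∀ {a o : K} (h : a ≤ o) (x : N.A a), φ o (N.j h x) = M.j h (φ a x)

/-- A net is trivial if it is isomorphic to a constant net bundle. -/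
def Net.IsTrivial (N : Net.{u} K) : Prop :=
  ∃ (F : Type u) (_ : CStarAlgebra F), Nonempty (Net.Iso N (Net.const K F))

/-- A net vanishes if it is isomorphic to the null net bundle, i.e. if all fibres are `{0}`. -/
def Net.Vanishes (N : Net.{u} K) : Prop := ∀ o, Subsingleton (N.A o)

/-! ### The ⋆-algebras generated by the symbols `(p, A)` -/

/-- The symbols `(p, A)`, with `p : a → o` a path and `A` in the fibre over `a`. -/
def Net.Symbol (N : Net.{u} K) (o : K) : Type (max u v) := Σ a : K, Path a o × N.A a

/-- The symbol `(p, A)` as an element of the free unital algebra. -/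
def Net.freeGen (N : Net.{u} K) {a o : K} (p : Path a o) (x : N.A a) :
    FreeAlgebra ℂ (N.Symbol o) := FreeAlgebra.ι ℂ ⟨a, p, x⟩

/-- The relations imposed on the symbols. -/
inductive Net.Rel (N : Net.{u} K) (o : K) :
    FreeAlgebra ℂ (N.Symbol o) → FreeAlgebra ℂ (N.Symbol o) → Prop
  | mul {a : K} (p : Path a o) (x y : N.A a) :
      Rel N o (N.freeGen p x * N.freeGen p y) (N.freeGen p (x * y))
  | add {a : K} (p : Path a o) (x y : N.A a) :
      Rel N o (N.freeGen p (x + y)) (N.freeGen p x + N.freeGen p y)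
  | smul {a : K} (p : Path a o) (c : ℂ) (x : N.A a) :
      Rel N o (N.freeGen p (c • x)) (c • N.freeGen p x)
  | one {a : K} (p : Path a o) : Rel N o (N.freeGen p (1 : N.A a)) 1
  | isotony {a a' : K} (h : a ≤ a') (p : Path a' o) (x : N.A a) :
      Rel N o (N.freeGen p (N.j h x)) (N.freeGen (p.comp (.single (Edge.ofLE h))) x)
  | homotopy {a : K} {p q : Path a o} (h : p.Homotopic q) (x : N.A a) :
      Rel N o (N.freeGen p x) (N.freeGen q x)

/-- The unital algebra over `o` generated by the symbols `(p, A)` subject to the relations. -/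
def Net.AlgFibre (N : Net.{u} K) (o : K) : Type (max u v) := RingQuot (N.Rel o)

instance (N : Net.{u} K) (o : K) : Ring (N.AlgFibre o) :=
  inferInstanceAs (Ring (RingQuot (N.Rel o)))

instance (N : Net.{u} K) (o : K) : Algebra ℂ (N.AlgFibre o) :=
  inferInstanceAs (Algebra ℂ (RingQuot (N.Rel o)))

/-- The element `(p, A)` of the algebra over `o`. -/
def Net.gen (N : Net.{u} K) {a o : K} (p : Path a o) (x : N.A a) : N.AlgFibre o :=
  RingQuot.mkAlgHom ℂ (N.Rel o) (N.freeGen p x)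

section Algebra

variable (N : Net.{u} K) {a o : K}

theorem Net.gen_mul (p : Path a o) (x y : N.A a) :
    N.gen p (x * y) = N.gen p x * N.gen p y := by
  have h := RingQuot.mkAlgHom_rel ℂ (Net.Rel.mul (N := N) p x y)
  rw [map_mul] at h
  exact h.symm

theorem Net.gen_add (p : Path a o) (x y : N.A a) :
    N.gen p (x + y) = N.gen p x + N.gen p y := by
  have h := RingQuot.mkAlgHom_rel ℂ (Net.Rel.add (N := N) p x y)
  rw [map_add] at h
  exact h

theorem Net.gen_smul (p : Path a o) (c : ℂ) (x : N.A a) :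
    N.gen p (c • x) = c • N.gen p x := by
  have h := RingQuot.mkAlgHom_rel ℂ (Net.Rel.smul (N := N) p c x)
  rw [map_smul] at h
  exact h

theorem Net.gen_one (p : Path a o) : N.gen p (1 : N.A a) = 1 := by
  have h := RingQuot.mkAlgHom_rel ℂ (Net.Rel.one (N := N) p)
  rw [map_one] at h
  exact h

theorem Net.gen_isotony {a' : K} (h : a ≤ a') (p : Path a' o) (x : N.A a) :
    N.gen p (N.j h x) = N.gen (p.comp (.single (Edge.ofLE h))) x :=
  RingQuot.mkAlgHom_rel ℂ (Net.Rel.isotony (N := N) h p x)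

theorem Net.gen_homotopy {p q : Path a o} (h : p.Homotopic q) (x : N.A a) :
    N.gen p x = N.gen q x :=
  RingQuot.mkAlgHom_rel ℂ (Net.Rel.homotopy (N := N) h x)

theorem Net.lift_freeGen {B : Type w} [Ring B] [Algebra ℂ B] (g : N.Symbol o → B)
    (p : Path a o) (x : N.A a) :
    FreeAlgebra.lift ℂ g (N.freeGen p x) = g ⟨a, p, x⟩ :=
  FreeAlgebra.lift_ι_apply _ _

/-- Maps out of the algebra over `o` are given by their values on the symbols. -/
def Net.algLift {B : Type w} [Ring B] [Algebra ℂ B] (g : ∀ a : K, Path a o → N.A a → B)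
    (hmul : ∀ a p x y, g a p (x * y) = g a p x * g a p y)
    (hadd : ∀ a p x y, g a p (x + y) = g a p x + g a p y)
    (hsmul : ∀ a p (c : ℂ) x, g a p (c • x) = c • g a p x)
    (hone : ∀ a p, g a p 1 = 1)
    (hiso : ∀ a a' (h : a ≤ a') p x,
      g a' p (N.j h x) = g a (p.comp (.single (Edge.ofLE h))) x)
    (hhom : ∀ a p q x, p.Homotopic q → g a p x = g a q x) :
    N.AlgFibre o →ₐ[ℂ] B :=
  RingQuot.liftAlgHom ℂ ⟨FreeAlgebra.lift ℂ (fun s : N.Symbol o => g s.1 s.2.1 s.2.2), by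
    intro x y h
    induction h with
    | mul p x y => simp [Net.lift_freeGen, hmul]
    | add p x y => simp [Net.lift_freeGen, hadd]
    | smul p c x => simp [Net.lift_freeGen, hsmul]
    | one p => simp [Net.lift_freeGen, hone]
    | isotony h p x => simp [Net.lift_freeGen, hiso]
    | homotopy h x => simpa [Net.lift_freeGen] using hhom _ _ _ x h⟩

theorem Net.algLift_gen {B : Type w} [Ring B] [Algebra ℂ B]
    (g : ∀ a : K, Path a o → N.A a → B) (h₁ h₂ h₃ h₄ h₅ h₆) (p : Path a o) (x : N.A a) :
    N.algLift g h₁ h₂ h₃ h₄ h₅ h₆ (N.gen p x) = g a p x := by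
  unfold Net.algLift Net.gen
  erw [RingQuot.liftAlgHom_mkAlgHom_apply]
  exact N.lift_freeGen _ p x

@[elab_as_elim]
theorem Net.alg_induction {motive : N.AlgFibre o → Prop}
    (gen : ∀ (a : K) (p : Path a o) (x : N.A a), motive (N.gen p x))
    (algebraMap : ∀ c : ℂ, motive (algebraMap ℂ _ c))
    (add : ∀ x y, motive x → motive y → motive (x + y))
    (mul : ∀ x y, motive x → motive y → motive (x * y)) (W : N.AlgFibre o) : motive W := by
  obtain ⟨W, rfl⟩ := RingQuot.mkAlgHom_surjective ℂ (N.Rel o) W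
  induction W using FreeAlgebra.induction with
  | grade0 c =>
    rw [AlgHom.commutes]
    exact algebraMap c
  | grade1 s => exact gen s.1 s.2.1 s.2.2
  | mul x y hx hy =>
    rw [map_mul]
    exact mul _ _ hx hy
  | add x y hx hy =>
    rw [map_add]
    exact add _ _ hx hy

/-- The opposite ring, with scalars acting through complex conjugation. Algebra maps into it
are the antimultiplicative, antilinear maps. -/
def ConjOp (R : Type w) : Type w := Rᵐᵒᵖ

instance (R : Type w) [Ring R] : Ring (ConjOp R) := inferInstanceAs (Ring Rᵐᵒᵖ)

instance (R : Type w) [Ring R] [Algebra ℂ R] : Algebra ℂ (ConjOp R) :=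
  RingHom.toAlgebra' ((algebraMap ℂ Rᵐᵒᵖ).comp (starRingEnd ℂ))
    fun _ x => Algebra.commutes (R := ℂ) (A := Rᵐᵒᵖ) _ x

/-- The element of the opposite ring given by an element of `R`. -/
def ConjOp.op {R : Type w} (x : R) : ConjOp R := MulOpposite.op x

/-- The element of `R` given by an element of the opposite ring. -/
def ConjOp.unop {R : Type w} (x : ConjOp R) : R := MulOpposite.unop x

/-- The adjoint: the antilinear antimultiplicative map with `(p, A)⋆ = (p, A⋆)`. -/
def Net.algStar (N : Net.{u} K) (o : K) : N.AlgFibre o →ₐ[ℂ] ConjOp (N.AlgFibre o) :=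
  N.algLift (fun _ p x => ConjOp.op (N.gen p (star x)))
    (fun _ p x y => by
      rw [star_mul, Net.gen_mul]
      rfl)
    (fun _ p x y => by
      rw [star_add, Net.gen_add]
      rfl)
    (fun _ p c x => by
      rw [star_smul, Net.gen_smul, Algebra.smul_def, Algebra.smul_def, Algebra.commutes]
      rfl)
    (fun _ p => by
      rw [star_one, Net.gen_one]
      rfl)
    (fun _ _ h p x => by rw [← map_star, Net.gen_isotony])
    (fun _ p q x h => by rw [Net.gen_homotopy N h])

instance (N : Net.{u} K) (o : K) : Star (N.AlgFibre o) := ⟨fun x => (N.algStar o x).unop⟩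

theorem Net.star_gen (p : Path a o) (x : N.A a) :
    star (N.gen p x) = N.gen p (star x) := by
  change (N.algStar o (N.gen p x)).unop = _
  rw [Net.algStar, Net.algLift_gen]
  rfl

theorem Net.alg_star_mul (x y : N.AlgFibre o) : star (x * y) = star y * star x := by
  change (N.algStar o (x * y)).unop = _
  rw [map_mul]
  rfl

theorem Net.alg_star_add (x y : N.AlgFibre o) : star (x + y) = star x + star y := by
  change (N.algStar o (x + y)).unop = _
  rw [map_add]
  rfl

theorem Net.alg_star_algebraMap (c : ℂ) :
    star (algebraMap ℂ (N.AlgFibre o) c) = algebraMap ℂ _ (star c) := by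
  change (N.algStar o (algebraMap ℂ _ c)).unop = _
  rw [AlgHom.commutes]
  rfl

instance (N : Net.{u} K) (o : K) : StarRing (N.AlgFibre o) where
  star_involutive W := by
    induction W using Net.alg_induction with
    | gen a p x => rw [Net.star_gen, Net.star_gen, star_star]
    | algebraMap c => rw [Net.alg_star_algebraMap, Net.alg_star_algebraMap, star_star]
    | add x y hx hy => rw [Net.alg_star_add, Net.alg_star_add, hx, hy]
    | mul x y hx hy => rw [Net.alg_star_mul, Net.alg_star_mul, hx, hy]
  star_mul := N.alg_star_mul
  star_add := N.alg_star_add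

instance (N : Net.{u} K) (o : K) : StarModule ℂ (N.AlgFibre o) where
  star_smul c x := by
    rw [Algebra.smul_def, Net.alg_star_mul, Net.alg_star_algebraMap, ← Algebra.commutes,
      Algebra.smul_def]

/-- A unital algebra map out of the algebra over `o` which preserves the adjoints of the symbols
is a ⋆-morphism. -/
def Net.algStarHom {B : Type w} [Ring B] [Algebra ℂ B] [StarRing B] [StarModule ℂ B]
    (f : N.AlgFibre o →ₐ[ℂ] B)
    (hf : ∀ (a : K) (p : Path a o) (x : N.A a), f (N.gen p (star x)) = star (f (N.gen p x))) :
    N.AlgFibre o →⋆ₐ[ℂ] B where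
  toAlgHom := f
  map_star' W := by
    change f (star W) = star (f W)
    induction W using Net.alg_induction with
    | gen a p x => rw [Net.star_gen, hf]
    | algebraMap c =>
      rw [Net.alg_star_algebraMap, AlgHom.commutes, AlgHom.commutes, algebraMap_star_comm]
    | add x y hx hy => rw [star_add, map_add, map_add, star_add, hx, hy]
    | mul x y hx hy => rw [star_mul, map_mul, map_mul, star_mul, hx, hy]

/-- Composition of all paths with a fixed path `r : o → o'`: `(p, A) ↦ (r * p, A)`. -/
def Net.algTransport {o' : K} (r : Path o o') : N.AlgFibre o →⋆ₐ[ℂ] N.AlgFibre o' :=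
  N.algStarHom
    (N.algLift (fun _ p x => N.gen (r.comp p) x)
      (fun _ _ _ _ => N.gen_mul _ _ _)
      (fun _ _ _ _ => N.gen_add _ _ _)
      (fun _ _ _ _ => N.gen_smul _ _ _)
      (fun _ _ => N.gen_one _)
      (fun _ _ h p x => by rw [N.gen_isotony, Path.comp_assoc])
      (fun _ _ _ x h => N.gen_homotopy (h.left r) x))
    (fun _ _ _ => by rw [Net.algLift_gen, Net.algLift_gen, Net.star_gen])

theorem Net.algTransport_gen {o' : K} (r : Path o o') (p : Path a o) (x : N.A a) :
    N.algTransport r (N.gen p x) = N.gen (r.comp p) x :=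
  N.algLift_gen _ _ _ _ _ _ _ p x

/-- The inclusion maps `(p, A) ↦ ((o' o) * p, A)` for `o ≤ o'`. -/
def Net.algIncl {o o' : K} (h : o ≤ o') : N.AlgFibre o →⋆ₐ[ℂ] N.AlgFibre o' :=
  N.algTransport (.single (Edge.ofLE h))

theorem Net.algIncl_comp {e a o : K} (h₁ : e ≤ a) (h₂ : a ≤ o) (W : N.AlgFibre e) :
    N.algIncl h₂ (N.algIncl h₁ W) = N.algIncl (h₁.trans h₂) W := by
  induction W using Net.alg_induction with
  | gen a p x =>
    simp only [Net.algIncl, Net.algTransport_gen, ← Path.comp_assoc]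
    exact N.gen_homotopy ((Path.homotopic_ofLE_trans h₁ h₂).right p) x
  | algebraMap c => simp only [AlgHomClass.commutes]
  | add x y hx hy => simp only [map_add, hx, hy]
  | mul x y hx hy => simp only [map_mul, hx, hy]

theorem Net.algIncl_surjective {o o' : K} (h : o ≤ o') :
    Function.Surjective (N.algIncl h) := by
  intro W
  refine ⟨N.algTransport (.single (Edge.ofLE h).opp) W, ?_⟩
  induction W using Net.alg_induction with
  | gen a p x =>
    simp only [Net.algIncl, Net.algTransport_gen, ← Path.comp_assoc]
    exact N.gen_homotopy (.trans _ _ _ ((Path.homotopic_comp_opp _).right p)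
      (Path.homotopic_degenerate_comp p)) x
  | algebraMap c => simp only [AlgHomClass.commutes]
  | add x y hx hy => simp only [map_add, hx, hy]
  | mul x y hx hy => simp only [map_mul, hx, hy]

end Algebra

/-! ### The enveloping net bundle -/

/-- A morphism from the net of ⋆-algebras generated by the symbols `(p, A)` to a C⋆-net bundle
over the same poset. The ⋆-morphisms between the fibres are not assumed to be unital. -/
structure Net.BundleMorphism (N : Net.{u} K) where
  B : Net.{max u v} K
  isNetBundle : B.IsNetBundle
  π : ∀ o, N.AlgFibre o →⋆ₙₐ[ℂ] B.A o
  comm : ∀ {a o : K} (h : a ≤ o) (W : N.AlgFibre a), π o (N.algIncl h W) = B.j h (π a W)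

/-- The seminorm `‖W‖ = sup_π ‖π_o(W)‖`, the supremum being over all morphisms to C⋆-net
bundles. -/
def Net.algNorm (N : Net.{u} K) {o : K} (W : N.AlgFibre o) : ℝ :=
  ⨆ π : N.BundleMorphism, ‖π.π o W‖

section Norm

variable (N : Net.{u} K) {o : K}

/-- The zero morphism. -/
instance : Nonempty N.BundleMorphism :=
  ⟨{ B := Net.const K (ULift.{max u v} Unit → ℂ)
     isNetBundle := fun _ => Function.bijective_id
     π := fun _ => 0
     comm := fun _ _ => rfl }⟩

theorem Net.BundleMorphism.norm_gen_le {N : Net.{u} K} (π : N.BundleMorphism) {a o : K}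
    (p : Path a o) (x : N.A a) : ‖π.π o (N.gen p x)‖ ≤ ‖x‖ := by
  let f : N.A a →⋆ₙₐ[ℂ] π.B.A o :=
    { toFun := fun x => π.π o (N.gen p x)
      map_smul' := fun c x => by
        rw [N.gen_smul, map_smul]
        rfl
      map_zero' := by
        have h := N.gen_smul p 0 (0 : N.A a)
        rw [zero_smul, zero_smul] at h
        rw [h, map_zero]
      map_add' := fun x y => by rw [N.gen_add, map_add]
      map_mul' := fun x y => by rw [N.gen_mul, map_mul]
      map_star' := fun x => by rw [← N.star_gen, map_star] }
  exact NonUnitalStarAlgHom.norm_apply_le f x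

theorem Net.bddAbove_norm (W : N.AlgFibre o) :
    BddAbove (Set.range fun π : N.BundleMorphism => ‖π.π o W‖) := by
  suffices ∃ C, ∀ π : N.BundleMorphism, ‖π.π o W‖ ≤ C by
    obtain ⟨C, hC⟩ := this
    exact ⟨C, by rintro _ ⟨π, rfl⟩; exact hC π⟩
  induction W using Net.alg_induction with
  | gen a p x => exact ⟨‖x‖, fun π => π.norm_gen_le p x⟩
  | algebraMap c =>
    refine ⟨‖c‖ * ‖(1 : N.A o)‖, fun π => ?_⟩
    rw [Algebra.algebraMap_eq_smul_one, map_smul, norm_smul,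
      ← N.gen_one (.single (Edge.degenerate o))]
    exact mul_le_mul_of_nonneg_left (π.norm_gen_le _ _) (norm_nonneg _)
  | add x y hx hy =>
    obtain ⟨C, hC⟩ := hx
    obtain ⟨D, hD⟩ := hy
    refine ⟨C + D, fun π => ?_⟩
    rw [map_add]
    exact (norm_add_le _ _).trans (add_le_add (hC π) (hD π))
  | mul x y hx hy =>
    obtain ⟨C, hC⟩ := hx
    obtain ⟨D, hD⟩ := hy
    refine ⟨C * D, fun π => ?_⟩
    rw [map_mul]
    exact (norm_mul_le _ _).trans
      (mul_le_mul (hC π) (hD π) (norm_nonneg _) ((norm_nonneg _).trans (hC π)))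

theorem Net.BundleMorphism.norm_le {N : Net.{u} K} (π : N.BundleMorphism) {o : K}
    (W : N.AlgFibre o) : ‖π.π o W‖ ≤ N.algNorm W :=
  le_ciSup (N.bddAbove_norm W) π

theorem Net.algNorm_le {W : N.AlgFibre o} {C : ℝ}
    (h : ∀ π : N.BundleMorphism, ‖π.π o W‖ ≤ C) : N.algNorm W ≤ C :=
  ciSup_le h

theorem Net.algNorm_nonneg (W : N.AlgFibre o) : 0 ≤ N.algNorm W :=
  Real.iSup_nonneg fun _ => norm_nonneg _

/-- The ring seminorm on the algebra over `o`. -/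
def Net.algSeminorm (N : Net.{u} K) (o : K) : RingSeminorm (N.AlgFibre o) where
  toFun := N.algNorm
  map_zero' := by simp [Net.algNorm]
  add_le' x y := N.algNorm_le fun π => by
    rw [map_add]
    exact (norm_add_le _ _).trans (add_le_add (π.norm_le x) (π.norm_le y))
  neg' x := by simp [Net.algNorm]
  mul_le' x y := N.algNorm_le fun π => by
    rw [map_mul]
    exact (norm_mul_le _ _).trans
      (mul_le_mul (π.norm_le x) (π.norm_le y) (norm_nonneg _) (N.algNorm_nonneg x))

instance (N : Net.{u} K) (o : K) : SeminormedRing (N.AlgFibre o) where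
  norm := N.algNorm
  dist x y := N.algNorm (-x + y)
  dist_self x := by simp [Net.algNorm]
  dist_comm x y := by
    have h := (N.algSeminorm o).neg' (-x + y)
    have e : -(-x + y) = -y + x := by abel
    rw [e] at h
    exact h.symm
  dist_triangle x y z := by
    have h := (N.algSeminorm o).add_le' (-x + y) (-y + z)
    have e : -x + y + (-y + z) = -x + z := by abel
    rw [e] at h
    exact h
  dist_eq _ _ := rfl
  norm_mul_le := (N.algSeminorm o).mul_le'

theorem Net.norm_def (W : N.AlgFibre o) : ‖W‖ = N.algNorm W := rfl

instance (N : Net.{u} K) (o : K) : NormedAlgebra ℂ (N.AlgFibre o) where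
  norm_smul_le c W := N.algNorm_le fun π => by
    rw [map_smul, norm_smul]
    exact mul_le_mul_of_nonneg_left (π.norm_le W) (norm_nonneg _)

instance (N : Net.{u} K) (o : K) : NormedStarGroup (N.AlgFibre o) where
  norm_star_le W := N.algNorm_le fun π => by
    rw [map_star, norm_star]
    exact π.norm_le W

theorem Net.norm_mul_self_le (W : N.AlgFibre o) : ‖W‖ * ‖W‖ ≤ ‖star W * W‖ := by
  have h : ‖W‖ ≤ Real.sqrt ‖star W * W‖ := N.algNorm_le fun π => by
    apply Real.le_sqrt_of_sq_le
    rw [sq, ← CStarRing.norm_star_mul_self, ← map_star, ← map_mul]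
    exact π.norm_le _
  calc ‖W‖ * ‖W‖ ≤ Real.sqrt ‖star W * W‖ * Real.sqrt ‖star W * W‖ :=
        mul_self_le_mul_self (norm_nonneg _) h
    _ = _ := Real.mul_self_sqrt (norm_nonneg _)

theorem Net.norm_algIncl {o o' : K} (h : o ≤ o') (W : N.AlgFibre o) :
    ‖N.algIncl h W‖ = ‖W‖ := by
  have key : ∀ π : N.BundleMorphism, ‖π.π o' (N.algIncl h W)‖ = ‖π.π o W‖ := fun π => by
    rw [π.comm h W]
    exact NonUnitalStarAlgHom.norm_map (π.B.j h) (π.B.j_injective h) _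
  simp only [Net.norm_def, Net.algNorm, key]

end Norm

/-! ### C⋆-completion of a ⋆-algebra with a C⋆-seminorm -/

section Completion

variable (R : Type w) [SeminormedRing R] [StarRing R]

theorem completion_uniformContinuous_star [NormedStarGroup R] : UniformContinuous (star : R → R) :=
  (isometry_iff_dist_eq.2 fun x y => by
    rw [dist_eq_norm, dist_eq_norm, ← star_sub, norm_star]).uniformContinuous

instance completionStar : Star (Completion R) := ⟨Completion.map star⟩

theorem completion_coe_star [NormedStarGroup R] (x : R) : star (x : Completion R) = ((star x : R) : Completion R) :=
  Completion.map_coe (completion_uniformContinuous_star R) x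

theorem completion_continuous_star : Continuous (star : Completion R → Completion R) :=
  Completion.continuous_map

instance completionStarRing [NormedStarGroup R] : StarRing (Completion R) where
  star_involutive x := by
    induction x using Completion.induction_on with
    | hp =>
      exact isClosed_eq ((completion_continuous_star R).comp (completion_continuous_star R))
        continuous_id
    | ih x => rw [completion_coe_star, completion_coe_star, star_star]
  star_mul x y := by
    induction x, y using Completion.induction_on₂ with
    | hp =>
      exact isClosed_eq ((completion_continuous_star R).comp continuous_mul)
        (((completion_continuous_star R).comp continuous_snd).mul
          ((completion_continuous_star R).comp continuous_fst))
    | ih x y =>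
      rw [← Completion.coe_mul, completion_coe_star, completion_coe_star, completion_coe_star,
        star_mul, Completion.coe_mul]
  star_add x y := by
    induction x, y using Completion.induction_on₂ with
    | hp =>
      exact isClosed_eq ((completion_continuous_star R).comp continuous_add)
        (((completion_continuous_star R).comp continuous_fst).add
          ((completion_continuous_star R).comp continuous_snd))
    | ih x y =>
      rw [← Completion.coe_add, completion_coe_star, completion_coe_star, completion_coe_star,
        star_add, Completion.coe_add]

/-- The completion of (the quotient by the null elements of) a ⋆-algebra with a C⋆-seminorm is a
C⋆-algebra. -/
@[reducible]
def completionCStarAlgebra [NormedStarGroup R] [NormedAlgebra ℂ R] [StarModule ℂ R]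
    (hR : ∀ x : R, ‖x‖ * ‖x‖ ≤ ‖star x * x‖) :
    CStarAlgebra (Completion R) where
  __ := (inferInstance : NormedRing (Completion R))
  __ := completionStarRing R
  __ := (inferInstance : Algebra ℂ (Completion R))
  complete := (inferInstance : CompleteSpace (Completion R)).complete
  norm_smul_le := norm_smul_le
  norm_mul_self_le x := by
    induction x using Completion.induction_on with
    | hp =>
      have := completion_continuous_star R
      exact isClosed_le (continuous_norm.mul continuous_norm)
        (continuous_norm.comp (this.mul continuous_id))
    | ih x =>
      rw [completion_coe_star, ← Completion.coe_mul, Completion.norm_coe, Completion.norm_coe]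
      exact hR x
  star_smul c x := by
    induction x using Completion.induction_on with
    | hp =>
      exact isClosed_eq ((completion_continuous_star R).comp (continuous_const_smul c))
        ((completion_continuous_star R).const_smul (star c))
    | ih x =>
      rw [← Completion.coe_smul, completion_coe_star, completion_coe_star, star_smul,
        Completion.coe_smul]

end Completion

instance (N : Net.{u} K) (o : K) : CStarAlgebra (Completion (N.AlgFibre o)) :=
  completionCStarAlgebra _ N.norm_mul_self_le

section Envelope

variable (N : Net.{u} K)

theorem Net.isometry_algIncl {o o' : K} (h : o ≤ o') : Isometry (N.algIncl h) :=
  AddMonoidHomClass.isometry_of_norm _ (N.norm_algIncl h)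

/-- The extension of the inclusion maps to the completions. -/
def Net.envIncl {o o' : K} (h : o ≤ o') :
    Completion (N.AlgFibre o) →⋆ₐ[ℂ] Completion (N.AlgFibre o') where
  toRingHom := Completion.mapRingHom (N.algIncl h : N.AlgFibre o →+* N.AlgFibre o')
    (N.isometry_algIncl h).continuous
  commutes' c := by
    change Completion.map (N.algIncl h) _ = _
    rw [Completion.algebraMap_def, Completion.algebraMap_def,
      Completion.map_coe (N.isometry_algIncl h).uniformContinuous, AlgHomClass.commutes]
  map_star' x := by
    change Completion.map (N.algIncl h) (star x) = star (Completion.map (N.algIncl h) x)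
    induction x using Completion.induction_on with
    | hp =>
      exact isClosed_eq (Completion.continuous_map.comp (completion_continuous_star _))
        ((completion_continuous_star _).comp Completion.continuous_map)
    | ih x =>
      have hu := (N.isometry_algIncl h).uniformContinuous
      rw [completion_coe_star, Completion.map_coe hu, Completion.map_coe hu,
        completion_coe_star, map_star]

theorem Net.envIncl_coe {o o' : K} (h : o ≤ o') (W : N.AlgFibre o) :
    N.envIncl h (W : Completion (N.AlgFibre o)) = (N.algIncl h W : N.AlgFibre o') :=
  Completion.map_coe (N.isometry_algIncl h).uniformContinuous W

theorem Net.isometry_envIncl {o o' : K} (h : o ≤ o') : Isometry (N.envIncl h) :=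
  (N.isometry_algIncl h).completion_map

/-- The enveloping net bundle of a net. -/
def Net.envelope : Net.{max u v} K where
  A o := Completion (N.AlgFibre o)
  j h := N.envIncl h
  j_injective h := (N.isometry_envIncl h).injective
  j_comp h₁ h₂ x := by
    induction x using Completion.induction_on with
    | hp =>
      exact isClosed_eq
        ((N.isometry_envIncl h₂).continuous.comp (N.isometry_envIncl h₁).continuous)
        (N.isometry_envIncl (h₁.trans h₂)).continuous
    | ih W => rw [N.envIncl_coe, N.envIncl_coe, N.envIncl_coe, N.algIncl_comp]

theorem Net.envelope_isNetBundle : N.envelope.IsNetBundle := by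
  intro a o h
  refine ⟨N.envelope.j_injective h, ?_⟩
  have hc : IsClosed (Set.range (N.envIncl h)) :=
    (N.isometry_envIncl h).isClosedEmbedding.isClosed_range
  intro y
  change y ∈ Set.range (N.envIncl h)
  induction y using Completion.induction_on with
  | hp => exact hc
  | ih W =>
    obtain ⟨V, rfl⟩ := N.algIncl_surjective h W
    exact ⟨V, N.envIncl_coe h V⟩

/-- A net is nondegenerate if its enveloping net bundle does not vanish. -/
def Net.Nondegenerate : Prop := ¬ N.envelope.Vanishes

end Envelope

/-! ### Representations -/

/-- A representation `(π, U)` of a net: Hilbert space representations `π_o` (not assumed to be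
unital) and unitaries `U_{ao} : H_o → H_a`, `o ≤ a`, with `U_{ao} ∈ (π_o, π_a ∘ j_{ao})` and
`U_{ea} U_{ao} = U_{eo}`. -/
structure Net.Representation (N : Net.{u} K) where
  H : K → Type (max u v)
  [normed : ∀ o, NormedAddCommGroup (H o)]
  [inner : ∀ o, InnerProductSpace ℂ (H o)]
  [complete : ∀ o, CompleteSpace (H o)]
  π : ∀ o, N.A o →⋆ₙₐ[ℂ] (H o →L[ℂ] H o)
  U : ∀ {o a : K}, o ≤ a → (H o ≃ₗᵢ[ℂ] H a)
  intertwines : ∀ {o a : K} (h : o ≤ a) (x : N.A o) (ξ : H o),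
    U h (π o x ξ) = π a (N.j h x) (U h ξ)
  U_comp : ∀ {o a e : K} (h₁ : o ≤ a) (h₂ : a ≤ e) (ξ : H o),
    U h₂ (U h₁ ξ) = U (h₁.trans h₂) ξ

attribute [instance] Net.Representation.normed Net.Representation.inner
  Net.Representation.complete

section Representation

variable {N : Net.{u} K} (ρ : N.Representation)

/-- `U_b = U_{∂₀b,|b|} U_{|b|,∂₁b}`, with `U_{∂₀b,|b|}` the inverse of `U_{|b|,∂₀b}`. -/
def Net.Representation.edgeU {x y : K} (b : Edge x y) : ρ.H x ≃ₗᵢ[ℂ] ρ.H y :=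
  (ρ.U b.source_le).trans (ρ.U b.target_le).symm

/-- `U_p = U_{b_n} ⋯ U_{b_1}` for a path `p = b_n * ⋯ * b_1`. -/
def Net.Representation.pathU : ∀ {x y : K}, Path x y → (ρ.H x ≃ₗᵢ[ℂ] ρ.H y)
  | _, _, .single b => ρ.edgeU b
  | _, _, .cons b p => (Net.Representation.pathU p).trans (ρ.edgeU b)

/-- A representation is quasi-trivial if `U_p ∈ (π_o, π_o)` for every loop `p : o → o`. -/
def Net.Representation.QuasiTrivial : Prop :=
  ∀ (o : K) (p : Path o o) (x : N.A o) (ξ : ρ.H o),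
    ρ.pathU p (ρ.π o x ξ) = ρ.π o x (ρ.pathU p ξ)

end Representation

end Nets

end CStarNet

end

/-! The envelope is a net bundle, so every path acts on its fibres by parallel transport, and
transport along `r` sends `(p, A)` to `(r * p, A)`. Over a pathwise connected poset, triviality
therefore means that `(p, A)` and `(q, A)` have the same class in the completion whenever `p` and
`q` have the same ends (`Net.envelope_isTrivial_of_gen_eq`, `Net.gen_eq_of_envelope_isTrivial`). The
theorem relates this equality to representations.

If the envelope is trivial, a unital representation extends to the symbols by `(p, A) ↦ U_p π(A)
U_p⋆` and is one of the morphisms in the supremum defining the seminorm. It thus identifies a loop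
with the constant one, which says that `U_p` commutes with `π(A)`. A general representation reduces
to this case: the projections `π_o(1)` are intertwined by the unitaries, and `π` vanishes on their
complements.

Conversely, the seminorm of `(p, A) - (q, A)` vanishes once every morphism `μ` into a net bundle `B`
kills it. Such a `μ` has to be turned into a representation of the net, with unitaries that compose
strictly. For this, fix a Hilbert space `H` and form over each `o` the Hilbert sum of all
representations of `B_o` on `H`. The isomorphisms of the bundle permute the index sets, and these
permutations are the unitaries. Quasi-triviality of this one representation gives a formula for
`μ(p, A)` in which `p` does not occur, and the GNS construction supplies an `H` on which a nonzero
difference would be visible. -/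

noncomputable section

open UniformSpace (Completion)

namespace CStarNet

/-! ### Faithfulness of the GNS representations -/

section GNS

open scoped ComplexOrder

/-- Positive functionals separate the points of a C⋆-algebra. -/
theorem exists_positive_map_star_mul_self_ne_zero {A : Type w} [CStarAlgebra A] [PartialOrder A]
    [StarOrderedRing A] {b : A} (hb : b ≠ 0) : ∃ f : A →ₚ[ℂ] ℂ, f (star b * b) ≠ 0 := by
  -- This closed cone contains all skew-adjoint elements as well as the positive ones; the former
  -- will force the separating functional to be real on positive elements.
  let C : Set A := {a | 0 ≤ a + star a}
  have hsmul : ∀ (t : ℝ), 0 ≤ t → ∀ a ∈ C, t • a ∈ C := fun t ht a ha => by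
    change 0 ≤ t • a + star (t • a)
    rw [star_smul, star_trivial, ← smul_add]
    exact smul_nonneg ht ha
  have hadd : ∀ a ∈ C, ∀ a' ∈ C, a + a' ∈ C := fun a ha a' ha' => by
    change 0 ≤ a + a' + star (a + a')
    rw [star_add, add_add_add_comm]
    exact add_nonneg ha ha'
  have hconv : Convex ℝ C := fun a ha a' ha' s t hs ht _ =>
    hadd _ (hsmul s hs a ha) _ (hsmul t ht a' ha')
  have hclosed : IsClosed C :=
    isClosed_le continuous_const (continuous_id.add continuous_star)
  have hnot : -(star b * b) ∉ C := fun h => by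
    change 0 ≤ -(star b * b) + star (-(star b * b)) at h
    rw [star_neg, star_mul, star_star, ← neg_add, neg_nonneg] at h
    have h0 := star_mul_self_nonneg b
    have h1 : star b * b ≤ 0 := (le_add_of_nonneg_left h0).trans h
    exact hb (CStarRing.star_mul_self_eq_zero_iff b |>.1 (le_antisymm h1 h0))
  obtain ⟨f, u, hfu, hfC⟩ :=
    RCLike.geometric_hahn_banach_point_closed (𝕜 := ℂ) hconv hclosed hnot
  have hu : u < 0 := by
    have := hfC 0 (by change (0 : A) ≤ 0 + star 0; simp)
    simpa using this
  have hpos : ∀ a ∈ C, 0 ≤ (f a).re := fun a ha => by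
    by_contra! hlt
    -- If `Re f(a) < 0`, this rescaling stays in the cone and attains the value `u` exactly, against
    -- the strict separation.
    have h := hfC _ (hsmul (u / (f a).re) (div_nonneg_of_nonpos hu.le hlt.le) a ha)
    rw [← Complex.coe_smul, map_smul, smul_eq_mul] at h
    simp only [RCLike.re_to_complex, Complex.re_ofReal_mul] at h
    rw [div_mul_cancel₀ _ hlt.ne] at h
    exact lt_irrefl _ h
  have hnn : ∀ a : A, 0 ≤ a → 0 ≤ f a := fun a ha => by
    have hsa : star a = a := (IsSelfAdjoint.of_nonneg ha).star_eq
    -- Both `i a` and `-i a` are skew-adjoint, hence in the cone, so `Im f(a) = 0`.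
    have h1 := hpos (Complex.I • a) (by
      change 0 ≤ Complex.I • a + star (Complex.I • a)
      simp [star_smul, hsa])
    have h2 := hpos (-(Complex.I • a)) (by
      change 0 ≤ -(Complex.I • a) + star (-(Complex.I • a))
      simp [star_smul, hsa])
    have h3 := hpos a (by
      change 0 ≤ a + star a
      rw [hsa]
      exact add_nonneg ha ha)
    rw [map_neg, map_smul, smul_eq_mul] at h2
    rw [map_smul, smul_eq_mul] at h1
    simp at h1 h2
    rw [Complex.nonneg_iff]
    exact ⟨h3, le_antisymm h2 h1⟩
  refine ⟨PositiveLinearMap.mk₀ f.toLinearMap hnn, fun h => ?_⟩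
  have h' : f (star b * b) = 0 := h
  rw [map_neg, h'] at hfu
  simp at hfu
  exact lt_asymm hu hfu

/-- Every nonzero element of a C⋆-algebra acts nontrivially in some Hilbert space
representation. -/
theorem exists_starAlgHom_apply_ne_zero {A : Type w} [CStarAlgebra A] {b : A} (hb : b ≠ 0) :
    ∃ (H : Type w) (_ : NormedAddCommGroup H) (_ : InnerProductSpace ℂ H) (_ : CompleteSpace H)
      (σ : A →⋆ₐ[ℂ] (H →L[ℂ] H)), σ b ≠ 0 := by
  let _ : PartialOrder A := CStarAlgebra.spectralOrder A
  have _ : StarOrderedRing A := CStarAlgebra.spectralOrderedRing A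
  obtain ⟨f, hf⟩ := exists_positive_map_star_mul_self_ne_zero hb
  refine ⟨f.GNS, inferInstance, inferInstance, inferInstance, f.gnsStarAlgHom, fun h => hf ?_⟩
  -- On the vector given by `1`, the operator of `b` has image of squared norm `f(b⋆ b)`.
  have h1 : f.gnsNonUnitalStarAlgHom b ((f.toPreGNS 1 : f.PreGNS) : f.GNS) = 0 :=
    congrArg (fun T : f.GNS →L[ℂ] f.GNS => T ((f.toPreGNS 1 : f.PreGNS) : f.GNS)) h
  rw [f.gnsNonUnitalStarAlgHom_apply_coe] at h1
  have h2 := congrArg norm h1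
  rw [Completion.norm_coe, norm_zero] at h2
  have h3 := f.preGNS_norm_sq (f.leftMulMapPreGNS b (f.toPreGNS 1))
  rw [h2] at h3
  simpa using h3.symm

end GNS

/-! ### Hilbert sums -/

section HilbertSum

open scoped ENNReal

variable {ι : Type v} {ι' : Type v} {H : Type w} [NormedAddCommGroup H]

theorem memℓp_comp_equiv (e : ι ≃ ι') (f : lp (fun _ : ι => H) 2) :
    Memℓp (E := fun _ : ι' => H) (fun i => f (e.symm i)) 2 := by
  have h := lp.memℓp f
  rw [memℓp_gen_iff (by norm_num)] at h ⊢
  exact e.symm.summable_iff.2 h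

variable [InnerProductSpace ℂ H]

/-- Reindexing of a Hilbert sum of copies of a fixed Hilbert space. -/
def lpReindex (e : ι ≃ ι') : lp (fun _ : ι => H) 2 ≃ₗᵢ[ℂ] lp (fun _ : ι' => H) 2 where
  toFun f := ⟨fun i => f (e.symm i), memℓp_comp_equiv e f⟩
  invFun f := ⟨fun i => f (e i), memℓp_comp_equiv e.symm f⟩
  left_inv f := by ext i; simp
  right_inv f := by ext i; simp
  map_add' f g := rfl
  map_smul' c f := rfl
  norm_map' f := by
    have h2 : 0 < (2 : ℝ≥0∞).toReal := by norm_num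
    change ‖(⟨fun i => f (e.symm i), memℓp_comp_equiv e f⟩ : lp (fun _ : ι' => H) 2)‖ = ‖f‖
    rw [lp.norm_eq_tsum_rpow h2, lp.norm_eq_tsum_rpow h2]
    congr 1
    exact e.symm.tsum_eq fun i => ‖f i‖ ^ (2 : ℝ≥0∞).toReal

variable [CompleteSpace H] {A : Type u} [CStarAlgebra A]

/-- ⋆-morphisms of C⋆-algebras are contractive, so `‖x‖` bounds all summands at once. Comparison
with the vector `‖x‖ • f` yields both square summability and the operator bound by monotonicity. -/
theorem norm_starAlgHom_apply_le (σ : ι → A →⋆ₙₐ[ℂ] (H →L[ℂ] H)) (x : A)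
    (f : lp (fun _ : ι => H) 2) (i : ι) : ‖σ i x (f i)‖ ≤ ‖(((‖x‖ : ℂ) • f) : lp _ 2) i‖ := by
  rw [lp.coeFn_smul, Pi.smul_apply, norm_smul, Complex.norm_real, norm_norm]
  exact ((σ i x).le_opNorm _).trans
    (mul_le_mul_of_nonneg_right (NonUnitalStarAlgHom.norm_apply_le (σ i) x) (norm_nonneg _))

/-- The action of an algebra element on a Hilbert sum of representations. -/
def hilbertSumOp (σ : ι → A →⋆ₙₐ[ℂ] (H →L[ℂ] H)) (x : A) :
    lp (fun _ : ι => H) 2 →L[ℂ] lp (fun _ : ι => H) 2 :=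
  LinearMap.mkContinuous
    { toFun := fun f => ⟨fun i => σ i x (f i),
        (lp.memℓp ((‖x‖ : ℂ) • f)).mono' (norm_starAlgHom_apply_le σ x f)⟩
      map_add' := fun f g => by ext i; exact map_add (σ i x) _ _
      map_smul' := fun c f => by ext i; exact map_smul (σ i x) _ _ } ‖x‖ fun f => by
    refine (lp.norm_mono (by norm_num) (norm_starAlgHom_apply_le σ x f)).trans ?_
    rw [norm_smul, Complex.norm_real, norm_norm]

theorem hilbertSumOp_apply (σ : ι → A →⋆ₙₐ[ℂ] (H →L[ℂ] H)) (x : A) (f : lp (fun _ : ι => H) 2)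
    (i : ι) : hilbertSumOp σ x f i = σ i x (f i) := rfl

/-- The Hilbert sum of a family of representations on a fixed Hilbert space. -/
def hilbertSum (σ : ι → A →⋆ₙₐ[ℂ] (H →L[ℂ] H)) :
    A →⋆ₙₐ[ℂ] (lp (fun _ : ι => H) 2 →L[ℂ] lp (fun _ : ι => H) 2) where
  toFun := hilbertSumOp σ
  map_smul' c x := by ext f i; simp [hilbertSumOp_apply]
  map_zero' := by ext f i; simp [hilbertSumOp_apply]
  map_add' x y := by ext f i; simp [hilbertSumOp_apply]
  map_mul' x y := by ext f i; simp [hilbertSumOp_apply]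
  map_star' x := by
    rw [ContinuousLinearMap.star_eq_adjoint, ContinuousLinearMap.eq_adjoint_iff]
    intro f g
    rw [lp.inner_eq_tsum, lp.inner_eq_tsum]
    congr 1
    ext i
    rw [hilbertSumOp_apply, hilbertSumOp_apply, map_star, ContinuousLinearMap.star_eq_adjoint,
      ContinuousLinearMap.adjoint_inner_left]

end HilbertSum

variable {K : Type v} [PartialOrder K]

/-! ### Parallel transport in net bundles -/

section Transport

/-- Not an axiom of a net: the map is idempotent by functoriality, and an injective idempotent map
is the identity. -/
theorem Net.j_refl (N : Net.{u} K) {a : K} (x : N.A a) : N.j le_rfl x = x :=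
  N.j_injective le_rfl (N.j_comp _ _ x)

/-- The degenerate 1-simplex is `(aa)`, so this is the isotony relation for `a ≤ a`. -/
theorem Net.gen_comp_degenerate (N : Net.{u} K) {a o : K} (p : Path a o) (x : N.A a) :
    N.gen (p.comp (.single (Edge.degenerate a))) x = N.gen p x := by
  have h := N.gen_isotony le_rfl p x
  rw [N.j_refl] at h
  exact h.symm

theorem Net.algTransport_comp (N : Net.{u} K) {a o e : K} (q : Path o e) (p : Path a o)
    (W : N.AlgFibre a) :
    N.algTransport (q.comp p) W = N.algTransport q (N.algTransport p W) := by
  induction W using Net.alg_induction with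
  | gen a r x => simp only [Net.algTransport_gen, Path.comp_assoc]
  | algebraMap c => simp only [AlgHomClass.commutes]
  | add x y hx hy => simp only [map_add, hx, hy]
  | mul x y hx hy => simp only [map_mul, hx, hy]

theorem Path.homotopic_ofLE_comp_edge {x y : K} (b : Edge x y) :
    Homotopic ((single (Edge.ofLE b.target_le)).comp (single b))
      (single (Edge.ofLE b.source_le)) :=
  .rel _ _ (.face ⟨Edge.ofLE b.target_le, Edge.ofLE b.source_le, b, b.support, le_rfl, le_rfl,
    le_rfl⟩)

/-- Seen from `|b|`, moving along `b` changes nothing, since `b` and the two inclusions into `|b|`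
bound a 2-simplex. This characterises the transport, because inclusions become injective in the
completion. -/
theorem Net.algIncl_algTransport_single (N : Net.{u} K) {x y : K} (b : Edge x y)
    (W : N.AlgFibre x) :
    N.algIncl b.target_le (N.algTransport (.single b) W) = N.algIncl b.source_le W := by
  simp only [Net.algIncl, ← Net.algTransport_comp]
  induction W using Net.alg_induction with
  | gen a r x =>
    simp only [Net.algTransport_gen]
    exact N.gen_homotopy ((Path.homotopic_ofLE_comp_edge b).right r) x
  | algebraMap c => simp only [AlgHomClass.commutes]
  | add x y hx hy => simp only [map_add, hx, hy]
  | mul x y hx hy => simp only [map_mul, hx, hy]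

variable {B : Net.{w} K} (hB : B.IsNetBundle)

/-- The inclusion maps of a net bundle as isomorphisms. -/
def Net.IsNetBundle.inclEquiv {a o : K} (h : a ≤ o) : B.A a ≃⋆ₐ[ℂ] B.A o :=
  StarAlgEquiv.ofBijective (B.j h) (hB h)

/-- Parallel transport along a 1-simplex. -/
def Net.IsNetBundle.edgeEquiv {x y : K} (b : Edge x y) : B.A x ≃⋆ₐ[ℂ] B.A y :=
  (hB.inclEquiv b.source_le).trans (hB.inclEquiv b.target_le).symm

/-- Parallel transport along a path. -/
def Net.IsNetBundle.pathEquiv : ∀ {x y : K}, Path x y → (B.A x ≃⋆ₐ[ℂ] B.A y)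
  | _, _, .single b => hB.edgeEquiv b
  | _, _, .cons b p => (Net.IsNetBundle.pathEquiv p).trans (hB.edgeEquiv b)

theorem Net.IsNetBundle.pathEquiv_single {x y : K} (b : Edge x y) :
    hB.pathEquiv (.single b) = hB.edgeEquiv b := by rw [Net.IsNetBundle.pathEquiv]

theorem Net.IsNetBundle.pathEquiv_cons {x y z : K} (b : Edge y z) (p : Path x y) (w : B.A x) :
    hB.pathEquiv (.cons b p) w = hB.edgeEquiv b (hB.pathEquiv p w) := by
  rw [Net.IsNetBundle.pathEquiv]
  rfl

theorem Net.IsNetBundle.j_edgeEquiv {x y : K} (b : Edge x y) (w : B.A x) :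
    B.j b.target_le (hB.edgeEquiv b w) = B.j b.source_le w :=
  (hB.inclEquiv b.target_le).apply_symm_apply (B.j b.source_le w)

theorem Net.IsNetBundle.pathEquiv_comp {x y z : K} (q : Path y z) (p : Path x y) (w : B.A x) :
    hB.pathEquiv (q.comp p) w = hB.pathEquiv q (hB.pathEquiv p w) := by
  induction q with
  | single b => rw [Path.comp, hB.pathEquiv_cons, hB.pathEquiv_single]
  | cons b q ih => rw [Path.comp, hB.pathEquiv_cons, hB.pathEquiv_cons, ih]

theorem Net.IsNetBundle.pathEquiv_ofLE {a o : K} (h : a ≤ o) (w : B.A a) :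
    hB.pathEquiv (.single (Edge.ofLE h)) w = B.j h w := by
  have := hB.j_edgeEquiv (Edge.ofLE h) w
  rw [hB.pathEquiv_single]
  exact B.j_injective _ (this.trans (B.j_refl (a := o) (B.j h w)).symm)

/-- A trivialisation of a net bundle intertwines parallel transport with the identity. -/
theorem Net.IsNetBundle.iso_pathEquiv {F : Type w} [CStarAlgebra F] (φ : Net.Iso B (.const K F))
    {x y : K} (p : Path x y) (w : B.A x) : φ.φ y (hB.pathEquiv p w) = φ.φ x w := by
  have hedge : ∀ {x y : K} (b : Edge x y) (w : B.A x), φ.φ y (hB.edgeEquiv b w) = φ.φ x w := by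
    intro x y b w
    have h₁ := φ.comm b.target_le (hB.edgeEquiv b w)
    have h₂ := φ.comm b.source_le w
    rw [hB.j_edgeEquiv, h₂] at h₁
    exact h₁.symm
  induction p with
  | single b => rw [hB.pathEquiv_single, hedge]
  | cons b p ih => rw [hB.pathEquiv_cons, hedge, ih]

/-- A net bundle over a pathwise connected poset whose parallel transport does not depend on the
path is trivial. -/
theorem Net.IsNetBundle.isTrivial_of_pathEquiv_eq (hK : PathConnected K)
    (h : ∀ {x y : K} (p q : Path x y) (w : B.A x), hB.pathEquiv p w = hB.pathEquiv q w) :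
    B.IsTrivial := by
  obtain ⟨⟨o⟩, hconn⟩ := hK
  -- Arbitrary paths to a base point trivialise the bundle; compatibility compares `r e * (ea)` with
  -- `r a`.
  let r : ∀ a, Path a o := fun a => (hconn a o).some
  refine ⟨B.A o, inferInstance, ⟨⟨fun a => hB.pathEquiv (r a), fun {a e} hae x => ?_⟩⟩⟩
  change hB.pathEquiv (r e) (B.j hae x) = hB.pathEquiv (r a) x
  rw [← hB.pathEquiv_ofLE, ← hB.pathEquiv_comp]
  exact h _ _ x

variable (N : Net.{u} K)

theorem Net.envelope_edgeEquiv_coe (hB : N.envelope.IsNetBundle) {x y : K} (b : Edge x y)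
    (W : N.AlgFibre x) :
    hB.edgeEquiv b (W : Completion (N.AlgFibre x)) =
      ((N.algTransport (.single b) W : N.AlgFibre y) : Completion (N.AlgFibre y)) := by
  apply N.envelope.j_injective b.target_le
  refine (hB.j_edgeEquiv b _).trans ((N.envIncl_coe b.source_le W).trans ?_)
  rw [← N.algIncl_algTransport_single]
  exact (N.envIncl_coe b.target_le _).symm

theorem Net.envelope_pathEquiv_coe (hB : N.envelope.IsNetBundle) {x y : K} (p : Path x y)
    (W : N.AlgFibre x) :
    hB.pathEquiv p (W : Completion (N.AlgFibre x)) =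
      ((N.algTransport p W : N.AlgFibre y) : Completion (N.AlgFibre y)) := by
  induction p with
  | single b =>
    rw [Net.IsNetBundle.pathEquiv_single]
    exact N.envelope_edgeEquiv_coe hB b W
  | cons b p ih =>
    refine (hB.pathEquiv_cons b p _).trans ((congrArg (hB.edgeEquiv b) ih).trans
      ((N.envelope_edgeEquiv_coe hB b _).trans ?_))
    rw [← N.algTransport_comp]
    rfl

/-- Independence of the path need only be checked on symbols: they generate a dense subalgebra, and
transport is isometric. -/
theorem Net.envelope_isTrivial_of_gen_eq (hK : PathConnected K)
    (h : ∀ {a o : K} (p q : Path a o) (x : N.A a),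
      ((N.gen p x : N.AlgFibre o) : Completion (N.AlgFibre o)) = (N.gen q x : N.AlgFibre o)) :
    N.envelope.IsTrivial := by
  have hB : N.envelope.IsNetBundle := N.envelope_isNetBundle
  refine hB.isTrivial_of_pathEquiv_eq hK fun {a o} p q w => ?_
  have hcont : ∀ p : Path a o, Continuous (hB.pathEquiv p) := fun p =>
    (NonUnitalStarAlgHom.isometry (hB.pathEquiv p) (hB.pathEquiv p).injective).continuous
  have hW : ∀ W : N.AlgFibre a, ((N.algTransport p W : N.AlgFibre o) : Completion (N.AlgFibre o)) =
      (N.algTransport q W : N.AlgFibre o) := fun W => by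
    induction W using Net.alg_induction with
    | gen a r x =>
      simp only [Net.algTransport_gen]
      exact h _ _ x
    | algebraMap c => rw [AlgHomClass.commutes, AlgHomClass.commutes]
    | add x y hx hy => rw [map_add, map_add, Completion.coe_add, Completion.coe_add, hx, hy]
    | mul x y hx hy => rw [map_mul, map_mul, Completion.coe_mul, Completion.coe_mul, hx, hy]
  change Completion (N.AlgFibre a) at w
  induction w using Completion.induction_on with
  | hp => exact isClosed_eq (hcont p) (hcont q)
  | ih W =>
    exact (N.envelope_pathEquiv_coe hB p W).trans
      ((hW W).trans (N.envelope_pathEquiv_coe hB q W).symm)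

/-- `(p, A)` is the transport along `p` of the symbol of `A` at the trivial loop, and a
trivialisation turns every transport into the identity. -/
theorem Net.gen_eq_of_envelope_isTrivial (h : N.envelope.IsTrivial) {a o : K} (p q : Path a o)
    (x : N.A a) :
    ((N.gen p x : N.AlgFibre o) : Completion (N.AlgFibre o)) = (N.gen q x : N.AlgFibre o) := by
  obtain ⟨F, _, ⟨φ⟩⟩ := h
  have hB : N.envelope.IsNetBundle := N.envelope_isNetBundle
  have key : ∀ p : Path a o,
      φ.φ o ((N.gen p x : N.AlgFibre o) : Completion (N.AlgFibre o)) =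
        φ.φ a ((N.gen (.single (Edge.degenerate a)) x : N.AlgFibre a) :
          Completion (N.AlgFibre a)) := fun p => by
    rw [← N.gen_comp_degenerate p x, ← N.algTransport_gen]
    exact (congrArg (φ.φ o) (N.envelope_pathEquiv_coe hB p _).symm).trans
      (hB.iso_pathEquiv φ p _)
  exact (φ.φ o).injective ((key p).trans (key q).symm)

end Transport

/-! ### Transport in representations -/

section Representation

namespace Net.Representation

variable {N : Net.{u} K} (ρ : N.Representation)

theorem U_refl {a : K} (ξ : ρ.H a) : ρ.U le_rfl ξ = ξ :=
  (ρ.U le_rfl).injective (ρ.U_comp _ _ ξ)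

theorem U_edgeU {x y : K} (b : Edge x y) (ξ : ρ.H x) :
    ρ.U b.target_le (ρ.edgeU b ξ) = ρ.U b.source_le ξ :=
  (ρ.U b.target_le).apply_symm_apply _

theorem edgeU_ofLE {a o : K} (h : a ≤ o) (ξ : ρ.H a) : ρ.edgeU (Edge.ofLE h) ξ = ρ.U h ξ :=
  (ρ.U le_rfl).injective ((ρ.U_edgeU (Edge.ofLE h) ξ).trans (ρ.U_refl (a := o) (ρ.U h ξ)).symm)

theorem pathU_single {x y : K} (b : Edge x y) : ρ.pathU (.single b) = ρ.edgeU b := by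
  rw [pathU]

theorem pathU_cons {x y z : K} (b : Edge y z) (p : Path x y) (ξ : ρ.H x) :
    ρ.pathU (.cons b p) ξ = ρ.edgeU b (ρ.pathU p ξ) := by
  rw [pathU]
  rfl

theorem pathU_ofLE {a o : K} (h : a ≤ o) (ξ : ρ.H a) :
    ρ.pathU (.single (Edge.ofLE h)) ξ = ρ.U h ξ := by
  rw [pathU_single, edgeU_ofLE]

theorem pathU_comp {x y z : K} (q : Path y z) (p : Path x y) (ξ : ρ.H x) :
    ρ.pathU (q.comp p) ξ = ρ.pathU q (ρ.pathU p ξ) := by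
  induction q with
  | single b => rw [Path.comp, pathU_cons, pathU_single]
  | cons b q ih => rw [Path.comp, pathU_cons, pathU_cons, ih]

/-- Once mapped into the fibre over `|c|`, each `U_b` becomes a mere comparison of two inclusions,
and these compose. -/
theorem edgeU_triangle {x y z : K} (c : Triangle x y z) (ξ : ρ.H x) :
    ρ.edgeU c.d0 (ρ.edgeU c.d2 ξ) = ρ.edgeU c.d1 ξ := by
  have key : ∀ {x y : K} (b : Edge x y) (h : b.support ≤ c.support) (ξ : ρ.H x),
      ρ.U (b.target_le.trans h) (ρ.edgeU b ξ) = ρ.U (b.source_le.trans h) ξ := by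
    intro x y b h ξ
    rw [← ρ.U_comp b.target_le h, ← ρ.U_comp b.source_le h, ρ.U_edgeU]
  apply (ρ.U (c.d0.target_le.trans c.d0_le)).injective
  rw [key c.d0 c.d0_le]
  exact (key c.d2 c.d2_le ξ).trans (key c.d1 c.d1_le ξ).symm

theorem pathU_deformation {x y : K} {p q : Path x y} (h : p.Deformation q) :
    ρ.pathU p = ρ.pathU q := by
  induction h with
  | face c =>
    ext ξ
    rw [pathU_cons, pathU_single, pathU_single, edgeU_triangle]
  | left r _ ih => ext ξ; rw [pathU_comp, pathU_comp, ih]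
  | right _ r ih => ext ξ; rw [pathU_comp, pathU_comp, ih]

theorem pathU_homotopic {x y : K} {p q : Path x y} (h : p.Homotopic q) :
    ρ.pathU p = ρ.pathU q := by
  induction h with
  | rel p q h => exact ρ.pathU_deformation h
  | refl _ => rfl
  | symm _ _ _ ih => exact ih.symm
  | trans _ _ _ _ _ ih₁ ih₂ => exact ih₁.trans ih₂

/-- The net bundle of the algebras of all bounded operators on the fibres, with the adjoint
action of the unitaries. -/
def operatorNet : Net.{max u v} K where
  A o := ρ.H o →L[ℂ] ρ.H o
  j h := (ρ.U h).conjStarAlgEquiv.toStarAlgHom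
  j_injective h := (ρ.U h).conjStarAlgEquiv.injective
  j_comp {e a o} h₁ h₂ x := by
    ext ξ
    obtain ⟨η, rfl⟩ := (ρ.U (h₁.trans h₂)).surjective ξ
    change ρ.U h₂ (ρ.U h₁ (x ((ρ.U h₁).symm ((ρ.U h₂).symm _)))) =
      ρ.U (h₁.trans h₂) (x ((ρ.U _).symm _))
    rw [LinearIsometryEquiv.symm_apply_apply, ← ρ.U_comp h₁ h₂,
      LinearIsometryEquiv.symm_apply_apply, LinearIsometryEquiv.symm_apply_apply, ρ.U_comp]

theorem operatorNet_isNetBundle : ρ.operatorNet.IsNetBundle :=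
  fun h => (ρ.U h).conjStarAlgEquiv.bijective

/-- The extension of a unital representation to the algebras generated by the symbols:
`(p, A) ↦ U_p π(A) U_p⋆`. -/
def algHom (h1 : ∀ o, ρ.π o 1 = 1) (o : K) : N.AlgFibre o →⋆ₐ[ℂ] (ρ.H o →L[ℂ] ρ.H o) :=
  N.algStarHom
    (N.algLift (fun a p x => (ρ.pathU p).conjStarAlgEquiv (ρ.π a x))
      (fun _ _ _ _ => by rw [map_mul, map_mul])
      (fun _ _ _ _ => by rw [map_add, map_add])
      (fun _ _ _ _ => by rw [map_smul, map_smul])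
      -- The relation `(p, 1) = 1` is what demands a unital representation.
      (fun _ _ => by rw [h1, map_one])
      (fun a a' h p x => by
        ext ξ
        obtain ⟨η, rfl⟩ := (ρ.pathU (p.comp (.single (Edge.ofLE h)))).surjective ξ
        rw [LinearIsometryEquiv.conjStarAlgEquiv_apply_apply,
          LinearIsometryEquiv.conjStarAlgEquiv_apply_apply,
          LinearIsometryEquiv.symm_apply_apply, pathU_comp, pathU_comp,
          LinearIsometryEquiv.symm_apply_apply, pathU_ofLE, pathU_ofLE, ρ.intertwines])
      (fun _ _ _ _ h => by rw [ρ.pathU_homotopic h]))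
    (fun _ _ _ => by rw [Net.algLift_gen, Net.algLift_gen, map_star, map_star])

theorem algHom_gen (h1 : ∀ o, ρ.π o 1 = 1) {a o : K} (p : Path a o) (x : N.A a) :
    ρ.algHom h1 o (N.gen p x) = (ρ.pathU p).conjStarAlgEquiv (ρ.π a x) :=
  N.algLift_gen _ _ _ _ _ _ _ p x

/-- The morphism to a net bundle defined by a unital representation. -/
def bundleMorphism (h1 : ∀ o, ρ.π o 1 = 1) : N.BundleMorphism where
  B := ρ.operatorNet
  isNetBundle := ρ.operatorNet_isNetBundle
  π o := (ρ.algHom h1 o : N.AlgFibre o →⋆ₙₐ[ℂ] (ρ.H o →L[ℂ] ρ.H o))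
  comm {a o} h W := by
    change ρ.algHom h1 o (N.algIncl h W) = (ρ.U h).conjStarAlgEquiv (ρ.algHom h1 a W)
    induction W using Net.alg_induction with
    | gen e p x =>
      rw [Net.algIncl, Net.algTransport_gen, algHom_gen, algHom_gen]
      ext ξ
      obtain ⟨η, rfl⟩ := (ρ.pathU ((Path.single (Edge.ofLE h)).comp p)).surjective ξ
      simp only [LinearIsometryEquiv.conjStarAlgEquiv_apply_apply,
        LinearIsometryEquiv.symm_apply_apply]
      simp only [pathU_comp, pathU_ofLE, LinearIsometryEquiv.symm_apply_apply]
    | algebraMap c => simp only [AlgHomClass.commutes]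
    | add x y hx hy => simp only [map_add, hx, hy]
    | mul x y hx hy => simp only [map_mul, hx, hy]

/-- The symbols of `x` at the loop `p` and at the trivial loop differ by a null element, which every
morphism to a net bundle kills; for the one built from `ρ` this reads `U_p π(x) U_p⋆ = π(x)`. -/
theorem quasiTrivial_of_map_one (h : N.envelope.IsTrivial) (h1 : ∀ o, ρ.π o 1 = 1) :
    ρ.QuasiTrivial := by
  intro o p x ξ
  have hgen := N.gen_eq_of_envelope_isTrivial h p (.single (Edge.ofLE (le_refl o))) x
  have hzero : ‖N.gen p x - N.gen (.single (Edge.ofLE (le_refl o))) x‖ = 0 := by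
    rw [← Completion.norm_coe, Completion.coe_sub, hgen, sub_self, norm_zero]
  have hle := (ρ.bundleMorphism h1).norm_le
    (N.gen p x - N.gen (.single (Edge.ofLE (le_refl o))) x)
  rw [← N.norm_def, hzero] at hle
  have heq := norm_le_zero_iff.1 hle
  rw [map_sub, sub_eq_zero] at heq
  have heq' : ρ.algHom h1 o (N.gen p x) =
    ρ.algHom h1 o (N.gen (.single (Edge.ofLE (le_refl o))) x) := heq
  rw [algHom_gen, algHom_gen] at heq'
  -- Evaluation at `U_p ξ` cancels `U_p⋆`.
  have hξ := congrArg (fun T : ρ.H o →L[ℂ] ρ.H o => T (ρ.pathU p ξ)) heq'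
  simp only [LinearIsometryEquiv.conjStarAlgEquiv_apply_apply,
    LinearIsometryEquiv.symm_apply_apply, pathU_ofLE, U_refl] at hξ
  rw [hξ]
  congr 1
  rw [LinearIsometryEquiv.symm_apply_eq, pathU_ofLE, U_refl]

/-- The subspace on which the unit acts as the identity. -/
def unitSpace (o : K) : Submodule ℂ (ρ.H o) :=
  LinearMap.eqLocus (ρ.π o 1).toLinearMap LinearMap.id

theorem mem_unitSpace {o : K} {ξ : ρ.H o} : ξ ∈ ρ.unitSpace o ↔ ρ.π o 1 ξ = ξ := Iff.rfl

theorem π_mem_unitSpace {o : K} (x : N.A o) (ξ : ρ.H o) : ρ.π o x ξ ∈ ρ.unitSpace o := by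
  rw [mem_unitSpace, ← mul_apply_eq_comp, ← map_mul, one_mul]

theorem U_mem_unitSpace {a o : K} (h : a ≤ o) {ξ : ρ.H a} (hξ : ξ ∈ ρ.unitSpace a) :
    ρ.U h ξ ∈ ρ.unitSpace o := by
  rw [mem_unitSpace] at hξ ⊢
  rw [← map_one (N.j h), ← ρ.intertwines, hξ]

theorem U_symm_mem_unitSpace {a o : K} (h : a ≤ o) {ξ : ρ.H o} (hξ : ξ ∈ ρ.unitSpace o) :
    (ρ.U h).symm ξ ∈ ρ.unitSpace a := by
  rw [mem_unitSpace] at hξ ⊢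
  apply (ρ.U h).injective
  rw [ρ.intertwines, map_one, LinearIsometryEquiv.apply_symm_apply, hξ]

instance (o : K) : CompleteSpace (ρ.unitSpace o) :=
  IsClosed.completeSpace_coe (hs := isClosed_eq (ρ.π o 1).continuous continuous_id)

/-- The restriction of an operator of the representation to the subspace on which the unit acts
as the identity. -/
def unitSpaceOp {o : K} (x : N.A o) : ρ.unitSpace o →L[ℂ] ρ.unitSpace o :=
  ((ρ.π o x).comp (ρ.unitSpace o).subtypeL).codRestrict _ fun ξ => ρ.π_mem_unitSpace x ξ

theorem coe_unitSpaceOp {o : K} (x : N.A o) (ξ : ρ.unitSpace o) :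
    (ρ.unitSpaceOp x ξ : ρ.H o) = ρ.π o x ξ := rfl

/-- The unital part of a representation. -/
def unitalPart : N.Representation where
  H o := ρ.unitSpace o
  π o :=
    { toFun := ρ.unitSpaceOp
      map_smul' := fun c x => by ext ξ; simp [coe_unitSpaceOp]
      map_zero' := by ext ξ; simp [coe_unitSpaceOp]
      map_add' := fun x y => by ext ξ; simp [coe_unitSpaceOp]
      map_mul' := fun x y => by ext ξ; simp [coe_unitSpaceOp]
      map_star' := fun x => by
        rw [ContinuousLinearMap.star_eq_adjoint, ContinuousLinearMap.eq_adjoint_iff]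
        intro ξ η
        rw [Submodule.coe_inner, Submodule.coe_inner, coe_unitSpaceOp, coe_unitSpaceOp, map_star,
          ContinuousLinearMap.star_eq_adjoint, ContinuousLinearMap.adjoint_inner_left] }
  U h :=
    { toFun := fun ξ => ⟨ρ.U h ξ, ρ.U_mem_unitSpace h ξ.2⟩
      invFun := fun ξ => ⟨(ρ.U h).symm ξ, ρ.U_symm_mem_unitSpace h ξ.2⟩
      left_inv := fun ξ => by ext; simp
      right_inv := fun ξ => by ext; simp
      map_add' := fun ξ η => by ext; simp
      map_smul' := fun c ξ => by ext; simp
      norm_map' := fun ξ => (ρ.U h).norm_map ξ }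
  intertwines h x ξ := Subtype.ext (ρ.intertwines h x ξ)
  U_comp h₁ h₂ ξ := Subtype.ext (ρ.U_comp h₁ h₂ ξ)

/-- The inclusion of the unital part of a representation. -/
def unitalPartIncl {o : K} (ξ : ρ.unitalPart.H o) : ρ.H o :=
  Subtype.val (p := (· ∈ ρ.unitSpace o)) ξ

theorem unitalPartIncl_injective {o : K} :
    Function.Injective (ρ.unitalPartIncl (o := o)) := Subtype.val_injective

theorem unitalPartIncl_U {a o : K} (h : a ≤ o) (ξ : ρ.unitalPart.H a) :
    ρ.unitalPartIncl (ρ.unitalPart.U h ξ) = ρ.U h (ρ.unitalPartIncl ξ) := rfl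

theorem unitalPartIncl_π {o : K} (x : N.A o) (ξ : ρ.unitalPart.H o) :
    ρ.unitalPartIncl (ρ.unitalPart.π o x ξ) = ρ.π o x (ρ.unitalPartIncl ξ) := rfl

theorem unitalPart_map_one (o : K) : ρ.unitalPart.π o 1 = 1 := by
  ext ξ
  apply ρ.unitalPartIncl_injective
  exact (ρ.unitalPartIncl_π 1 ξ).trans ξ.2

theorem unitalPartIncl_edgeU {x y : K} (b : Edge x y) (ξ : ρ.unitalPart.H x) :
    ρ.unitalPartIncl (ρ.unitalPart.edgeU b ξ) = ρ.edgeU b (ρ.unitalPartIncl ξ) := by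
  apply (ρ.U b.target_le).injective
  rw [← unitalPartIncl_U, U_edgeU, U_edgeU, unitalPartIncl_U]

theorem unitalPartIncl_pathU {x y : K} (p : Path x y) (ξ : ρ.unitalPart.H x) :
    ρ.unitalPartIncl (ρ.unitalPart.pathU p ξ) = ρ.pathU p (ρ.unitalPartIncl ξ) := by
  induction p with
  | single b => rw [pathU_single, pathU_single, unitalPartIncl_edgeU]
  | cons b p ih => rw [pathU_cons, pathU_cons, unitalPartIncl_edgeU, ih]

/-- The inclusions of the net are unital, so the unitaries carry the projections `π(1)` to one
another. -/
theorem pathU_π_one {x y : K} (p : Path x y) (ξ : ρ.H x) :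
    ρ.pathU p (ρ.π x 1 ξ) = ρ.π y 1 (ρ.pathU p ξ) := by
  have hedge : ∀ {x y : K} (b : Edge x y) (ξ : ρ.H x),
      ρ.edgeU b (ρ.π x 1 ξ) = ρ.π y 1 (ρ.edgeU b ξ) := by
    intro x y b ξ
    apply (ρ.U b.target_le).injective
    rw [ρ.U_edgeU, ρ.intertwines, ρ.intertwines, ρ.U_edgeU, map_one (N.j _), map_one (N.j _)]
  induction p with
  | single b => rw [pathU_single, hedge]
  | cons b p ih => rw [pathU_cons, pathU_cons, ih, hedge]

/-- Since `π(x) = π(x) π(1)`, the commutation with `U_p` may be tested on vectors `π(1) ξ`, which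
lie in the unital part. -/
theorem quasiTrivial_of_isTrivial (h : N.envelope.IsTrivial) : ρ.QuasiTrivial := by
  intro o p x ξ
  have hπ : ∀ ξ, ρ.π o x (ρ.π o 1 ξ) = ρ.π o x ξ := fun ξ => by
    rw [← mul_apply_eq_comp, ← map_mul, mul_one]
  have key : ∀ η : ρ.unitalPart.H o,
      ρ.pathU p (ρ.π o x (ρ.unitalPartIncl η)) = ρ.π o x (ρ.pathU p (ρ.unitalPartIncl η)) :=
    fun η => by
      rw [← unitalPartIncl_π, ← unitalPartIncl_pathU, ← unitalPartIncl_pathU, ← unitalPartIncl_π,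
        ρ.unitalPart.quasiTrivial_of_map_one h ρ.unitalPart_map_one o p x η]
  have hξ : ρ.pathU p (ρ.π o x (ρ.π o 1 ξ)) = ρ.π o x (ρ.pathU p (ρ.π o 1 ξ)) :=
    key ⟨ρ.π o 1 ξ, ρ.π_mem_unitSpace 1 ξ⟩
  rwa [hπ, pathU_π_one, hπ] at hξ

end Net.Representation

end Representation

/-! ### The representation induced by a morphism to a net bundle -/

section Induced

/-- The symbols `(p, A)` with a fixed path `p` as a ⋆-morphism. -/
def Net.genHom (N : Net.{u} K) {a o : K} (p : Path a o) : N.A a →⋆ₙₐ[ℂ] N.AlgFibre o where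
  toFun := N.gen p
  map_smul' := N.gen_smul p
  map_zero' := by
    have h := N.gen_smul p 0 (0 : N.A a)
    rwa [zero_smul, zero_smul] at h
  map_add' := N.gen_add p
  map_mul' := N.gen_mul p
  map_star' x := (N.star_gen p x).symm

namespace Net.BundleMorphism

variable {N : Net.{u} K} (μ : N.BundleMorphism)
variable (H : Type (max u v)) [NormedAddCommGroup H] [InnerProductSpace ℂ H] [CompleteSpace H]

/-- Representations of the fibres of a net bundle on a fixed Hilbert space, transported by the
inclusion maps. -/
def fibreRepEquiv {B : Net.{w} K} (hB : B.IsNetBundle) (H : Type (max u v))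
    [NormedAddCommGroup H] [InnerProductSpace ℂ H] [CompleteSpace H] {a o : K} (h : a ≤ o) :
    (B.A a →⋆ₐ[ℂ] (H →L[ℂ] H)) ≃ (B.A o →⋆ₐ[ℂ] (H →L[ℂ] H)) where
  toFun α := α.comp ((hB.inclEquiv h).symm : B.A o →⋆ₐ[ℂ] B.A a)
  invFun α := α.comp (B.j h)
  left_inv α := by
    ext1 x
    exact congrArg α ((hB.inclEquiv h).symm_apply_apply x)
  right_inv α := by
    ext1 x
    exact congrArg α ((hB.inclEquiv h).apply_symm_apply x)

/-- The Hilbert sum of all representations of a fibre of the net bundle on the space `H`. -/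
def fibreSum (o : K) :
    μ.B.A o →⋆ₙₐ[ℂ] (lp (fun _ : μ.B.A o →⋆ₐ[ℂ] (H →L[ℂ] H) => H) 2 →L[ℂ]
      lp (fun _ : μ.B.A o →⋆ₐ[ℂ] (H →L[ℂ] H) => H) 2) :=
  hilbertSum fun α => (α : μ.B.A o →⋆ₙₐ[ℂ] (H →L[ℂ] H))

theorem fibreSum_apply {o : K} (b : μ.B.A o)
    (f : lp (fun _ : μ.B.A o →⋆ₐ[ℂ] (H →L[ℂ] H) => H) 2) (α : μ.B.A o →⋆ₐ[ℂ] (H →L[ℂ] H)) :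
    μ.fibreSum H o b f α = α b (f α) := rfl

/-- The component at `α` of the reindexed vector is the old one at `α ∘ j`, where `b` acts by `(α ∘
j)(b) = α(j b)`. -/
theorem lpReindex_fibreSum {a o : K} (h : a ≤ o) (b : μ.B.A a)
    (f : lp (fun _ : μ.B.A a →⋆ₐ[ℂ] (H →L[ℂ] H) => H) 2) :
    lpReindex (fibreRepEquiv μ.isNetBundle H h) (μ.fibreSum H a b f) =
      μ.fibreSum H o (μ.B.j h b) (lpReindex (fibreRepEquiv μ.isNetBundle H h) f) := rfl

/-- The representation of the net on the Hilbert sums of all representations of the fibres of the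
net bundle on the space `H`. -/
def inducedRep : N.Representation where
  H o := lp (fun _ : μ.B.A o →⋆ₐ[ℂ] (H →L[ℂ] H) => H) 2
  π o := (μ.fibreSum H o).comp ((μ.π o).comp (N.genHom (.single (Edge.degenerate o))))
  U h := lpReindex (fibreRepEquiv μ.isNetBundle H h)
  intertwines {o a} h x ξ := by
    -- Both sides are the image under `μ` of the symbol of `x` along `(ao)`, as degenerate
    -- 1-simplices can be absorbed on either side.
    have key : μ.B.j h (μ.π o (N.gen (.single (Edge.degenerate o)) x)) =
        μ.π a (N.gen (.single (Edge.degenerate a)) (N.j h x)) := by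
      rw [← μ.comm, Net.algIncl, Net.algTransport_gen, Net.gen_comp_degenerate, Net.gen_isotony,
        N.gen_homotopy (Path.homotopic_degenerate_comp _)]
    exact (μ.lpReindex_fibreSum H h _ ξ).trans
      (congrArg (fun b => μ.fibreSum H a b (lpReindex (fibreRepEquiv μ.isNetBundle H h) ξ)) key)
  U_comp {o a e} h₁ h₂ ξ := by
    ext α
    -- Reindexing is precomposition with the inclusion maps, hence strictly functorial.
    have : (α.comp (μ.B.j h₂)).comp (μ.B.j h₁) = α.comp (μ.B.j (h₁.trans h₂)) := by
      ext1 x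
      exact congrArg α (μ.B.j_comp h₁ h₂ x)
    exact congrArg ξ this

/-- The action of a fibre of the net bundle on the Hilbert space of the induced representation. -/
def inducedAct (o : K) (b : μ.B.A o) : (μ.inducedRep H).H o →L[ℂ] (μ.inducedRep H).H o :=
  μ.fibreSum H o b

theorem inducedRep_π {o : K} (x : N.A o) :
    (μ.inducedRep H).π o x =
      μ.inducedAct H o (μ.π o (N.gen (.single (Edge.degenerate o)) x)) := rfl

theorem inducedRep_U_inducedAct {a o : K} (h : a ≤ o) (b : μ.B.A a) (ξ : (μ.inducedRep H).H a) :
    (μ.inducedRep H).U h (μ.inducedAct H a b ξ) =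
      μ.inducedAct H o (μ.B.j h b) ((μ.inducedRep H).U h ξ) := μ.lpReindex_fibreSum H h b ξ

/-- Every `σ` on `H` is itself a summand; vectors concentrated there recover it. -/
theorem apply_eq_of_inducedAct_eq {o : K} {b c : μ.B.A o}
    (h : ∀ ξ, μ.inducedAct H o b ξ = μ.inducedAct H o c ξ) (σ : μ.B.A o →⋆ₐ[ℂ] (H →L[ℂ] H)) :
    σ b = σ c := by
  classical
  ext ζ
  have h' := congrArg (fun f : lp (fun _ : μ.B.A o →⋆ₐ[ℂ] (H →L[ℂ] H) => H) 2 => f σ)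
    (h (lp.single 2 σ ζ))
  change μ.fibreSum H o b (lp.single 2 σ ζ) σ = μ.fibreSum H o c (lp.single 2 σ ζ) σ at h'
  simpa only [fibreSum_apply, lp.single_apply_self] using h'

theorem inducedRep_edgeU_inducedAct {x y : K} (b : Edge x y) (W : N.AlgFibre x)
    (ξ : (μ.inducedRep H).H x) :
    (μ.inducedRep H).edgeU b (μ.inducedAct H x (μ.π x W) ξ) =
      μ.inducedAct H y (μ.π y (N.algTransport (.single b) W)) ((μ.inducedRep H).edgeU b ξ) := by
  apply ((μ.inducedRep H).U b.target_le).injective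
  rw [Net.Representation.U_edgeU, inducedRep_U_inducedAct, inducedRep_U_inducedAct,
    Net.Representation.U_edgeU, ← μ.comm, ← μ.comm, N.algIncl_algTransport_single]

theorem inducedRep_pathU_inducedAct {a o : K} (p : Path a o) (W : N.AlgFibre a)
    (ξ : (μ.inducedRep H).H a) :
    (μ.inducedRep H).pathU p (μ.inducedAct H a (μ.π a W) ξ) =
      μ.inducedAct H o (μ.π o (N.algTransport p W)) ((μ.inducedRep H).pathU p ξ) := by
  induction p with
  | single b => rw [Net.Representation.pathU_single, inducedRep_edgeU_inducedAct]
  | cons b p ih =>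
    rw [Net.Representation.pathU_cons, Net.Representation.pathU_cons, ih,
      inducedRep_edgeU_inducedAct, ← N.algTransport_comp]
    rfl

/-- With one return path `s : o → a` fixed, `s * p` is a loop for every `p : a → o`. Commutation
with its unitary makes `μ(p, x)` act as `U_s⋆ π(x) U_s`, whatever `p` is. -/
theorem π_gen_eq_of_quasiTrivial (hK : PathConnected K)
    (hN : ∀ ρ : N.Representation, ρ.QuasiTrivial) {a o : K} (p q : Path a o) (x : N.A a) :
    μ.π o (N.gen p x) = μ.π o (N.gen q x) := by
  by_contra hne
  -- The space `H` is chosen after the offending difference, so no single `H` has to separate all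
  -- elements.
  obtain ⟨H, _, _, _, σ, hσ⟩ := exists_starAlgHom_apply_ne_zero (sub_ne_zero.2 hne)
  obtain ⟨s⟩ := hK.2 o a
  have key : ∀ (p : Path a o) (η : (μ.inducedRep H).H o),
      μ.inducedAct H o (μ.π o (N.gen p x)) η = ((μ.inducedRep H).pathU s).symm
        ((μ.inducedRep H).π a x ((μ.inducedRep H).pathU s η)) := by
    intro p η
    -- For `η = U_p ξ` the left side is `U_p π(x) ξ`, and the claim becomes commutation of `U_{s *
    -- p}` with `π(x)`.
    obtain ⟨ξ, rfl⟩ := ((μ.inducedRep H).pathU p).surjective η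
    rw [← N.gen_comp_degenerate p x, ← N.algTransport_gen, ← μ.inducedRep_pathU_inducedAct,
      ← inducedRep_π, LinearIsometryEquiv.eq_symm_apply, ← Net.Representation.pathU_comp,
      hN (μ.inducedRep H) a (s.comp p) x ξ, Net.Representation.pathU_comp]
  apply hσ
  rw [map_sub, sub_eq_zero]
  exact μ.apply_eq_of_inducedAct_eq H (fun η => (key p η).trans (key q η).symm) σ

end Net.BundleMorphism

theorem Net.envelope_isTrivial_of_quasiTrivial {N : Net.{u} K} (hK : PathConnected K)
    (hN : ∀ ρ : N.Representation, ρ.QuasiTrivial) : N.envelope.IsTrivial := by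
  refine N.envelope_isTrivial_of_gen_eq hK fun {a o} p q x => ?_
  rw [← sub_eq_zero, ← Completion.coe_sub, ← norm_eq_zero, Completion.norm_coe]
  refine le_antisymm (N.algNorm_le fun μ => ?_) (norm_nonneg _)
  rw [map_sub, μ.π_gen_eq_of_quasiTrivial hK hN p q x, sub_self, norm_zero]

end Induced

end CStarNet

end

theorem mainTheorem10 {K : Type v} [PartialOrder K] (hK : CStarNet.PathConnected K)
    (N : CStarNet.Net.{u} K) (hN : N.Nondegenerate) :
    N.envelope.IsTrivial ↔ ∀ ρ : N.Representation, ρ.QuasiTrivial := by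
  exact ⟨fun h ρ => ρ.quasiTrivial_of_isTrivial h,
    fun h => CStarNet.Net.envelope_isTrivial_of_quasiTrivial hK h⟩
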